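/- Let $\mu,\nu,t\in\mathbb C$ with $\operatorname{Re}(\mu+\nu)>-1$, and let $$w(z)=(1+z)^{\mu}(1+1/z)^{\nu}e^{tz},\qquad |z|=1,$$ (principal powers), with Fourier coefficients $w_k=\int_{\mathbb T}\frac{dz}{2\pi i z}\,w(z)z^{-k}$. Assume that the Toeplitz determinants $I^0_n=\det[w_{j-k}]_{0\le j,k\le n-1}$ are non-zero for all $n\ge 1$. Then there is a system of orthogonal polynomials on the unit circle for $w$: polynomials $\phi_n,\bar\phi_n\in\mathbb C[z]$ of degree $n$ ($n\ge 0$), with the same leading coefficient $\kappa_n$, such that $$\int_{\mathbb T}\frac{dz}{2\pi i z}\,\frac{w(z)}{w_0}\,\phi_m(z)\,\bar\phi_n(1/z)=\delta_{m,n}\qquad(m,n\ge 0).$$ (Here $\bar\phi_n$ is in general not the complex conjugate of $\phi_n$, since $w$ need not be real.) For every such system the reflection coefficients $r_n=\phi_n(0)/\kappa_n$ and $\bar r_n=\bar\phi_n(0)/\kappa_n$ satisfy, for every integer $N\ge 1$, the following coupled pair of recurrences, each of order one in $r$ and of order one in $\bar r$: $$(1-r_N\bar r_N)\,[t r_{N+1}+(N+\nu)r_N]\,[t\bar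 r_{N-1}+(N+\nu)\bar r_N]=[(N+\nu)r_N\bar r_N+\mu]\,[\nu-(N+\nu)r_N\bar r_N]$$ and $$t^2r_N^2\bar r_{N-1}^2+t(\nu-\mu-t)r_N\bar r_{N-1}-(N+\nu)(N-1+\nu)\bar r_N r_{N-1}-(N-1+\nu)t\,r_{N-1}\bar r_{N-1}-(N+\nu)t\,r_N\bar r_N-\mu\nu=0.$$ -/

import Mathlib

open scoped Polynomial

noncomputable section

namespace PVWeight

/-- The contour integral `∫_𝕋 dz/(2πiz) f(z)` over the unit circle, written with
`z = e^{iθ}`, `-π < θ ≤ π`. -/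
def circleMean (f : ℂ → ℂ) : ℂ :=
  (1 / (2 * (Real.pi : ℂ))) *
    ∫ θ in (-Real.pi)..Real.pi, f (Complex.exp ((θ : ℂ) * Complex.I))

/-- The Fourier coefficient `w_k = ∫_𝕋 dz/(2πiz) w(z) z^{-k}` of a weight. -/
def fourierCoeff (w : ℂ → ℂ) (k : ℤ) : ℂ :=
  circleMean fun z => w z * z ^ (-k)

/-- The Toeplitz determinant `I_n⁰[w] = det [w_{j-k}]` with `0 ≤ j, k ≤ n-1`. -/
def toeplitzDet (w : ℂ → ℂ) (n : ℕ) : ℂ :=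
  Matrix.det (Matrix.of fun j k : Fin n =>
    fourierCoeff w (((j : ℕ) : ℤ) - ((k : ℕ) : ℤ)))

/-- The weight `w(z) = (1+z)^μ (1+1/z)^ν e^{tz}`, with principal powers. -/
def weight (μ ν t : ℂ) (z : ℂ) : ℂ :=
  (1 + z) ^ μ * (1 + 1 / z) ^ ν * Complex.exp (t * z)

/-- `(φ, φbar)` is a system of orthogonal polynomials on the unit circle for the complex
weight `w`, normalised by `w_0`. For a complex weight the coefficients of `φbar n` are
independent of those of `φ n`, and the conjugate of `φ_n(z)` in the orthonormality relation is
`φbar_n(1/z)`; for a real weight one may take for `φbar n` the polynomial with the conjugate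
coefficients. The leading coefficient `κ_n` is common to `φ n` and `φbar n`. -/
structure IsOrthonormalSystem (w : ℂ → ℂ) (φ φbar : ℕ → ℂ[X]) : Prop where
  natDegree_eq : ∀ n, (φ n).natDegree = n
  natDegree_bar_eq : ∀ n, (φbar n).natDegree = n
  leadingCoeff_eq : ∀ n, (φbar n).leadingCoeff = (φ n).leadingCoeff
  orthonormal : ∀ m n : ℕ,
    circleMean (fun z => w z / fourierCoeff w 0 * (φ m).eval z * (φbar n).eval (1 / z))
      = if m = n then 1 else 0

/-- The ratio `φ_n(0)/κ_n` of the constant coefficient and the leading coefficient: the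
reflection coefficient `r_n` for the sequence `φ`, and `r̄_n` for the sequence `φbar`. -/
def reflectionCoeff (φ : ℕ → ℂ[X]) (n : ℕ) : ℂ :=
  (φ n).eval 0 / (φ n).leadingCoeff

end PVWeight

end

/-! ### Biorthogonal polynomials for a Toeplitz form: Szegő recurrences and norms. -/

noncomputable section

namespace PVWeight

open Polynomial

/-! Let `B p q` be the integral of w(z)p(z)q(1/z). Rescaling an orthonormal system gives monic
biorthogonal P_n, Q_n with norms h_n and constant terms r_n, r̄_n, so the recurrences become algebra
in `B`. Since `B` is unchanged when both arguments are multiplied by X, the Szegő recurrences hold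
(`szego`); they tie the subleading and linear coefficients to r, r̄ and give h_{n+1} = (1 - r_{n+1}
r̄_{n+1}) h_n.

The specific weight enters through one identity: z w'/w times 1+1/z is the Laurent polynomial μ + t
+ tz - ν/z. Integrating the derivative of w(z)(1+1/z)p(z)q(1/z) around the circle gives
`IsSemiclassical`; the boundary terms at z = -1 vanish because Re(μ+ν)+1 > 0
(`isSemiclassical_circleForm`).

With p* the reversal of p, testing this on (P_n, Q_n), (P_n, P_n*) and (Q_n*, Q_n) gives three
relations. Eliminating the subleading coefficients leaves `right_recurrence` and `left_recurrence`,
of second order in r̄ and r. The quadratic relation is a first integral of this pair, with value 0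
at the start (`quadratic_relation`); the product relation is that integral plus a multiple of
`left_recurrence`.

Existence is linear algebra: non-zero determinants allow the orthogonality equations to be solved
and force h_n ≠ 0. -/

/-- A bilinear form on polynomials whose Gram matrix is a Toeplitz matrix. -/
def IsToeplitz (B : ℂ[X] →ₗ[ℂ] ℂ[X] →ₗ[ℂ] ℂ) : Prop :=
  ∀ p q, B (X * p) (X * q) = B p q

/-- Monic biorthogonal polynomials for a bilinear form on polynomials. -/
structure IsMonicBiorthogonal (B : ℂ[X] →ₗ[ℂ] ℂ[X] →ₗ[ℂ] ℂ) (P Q : ℕ → ℂ[X]) (h : ℕ → ℂ) :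
    Prop where
  coeff_left : ∀ n, (P n).coeff n = 1
  coeff_right : ∀ n, (Q n).coeff n = 1
  coeff_left_of_lt : ∀ n m, n < m → (P n).coeff m = 0
  coeff_right_of_lt : ∀ n m, n < m → (Q n).coeff m = 0
  orth : ∀ m n, B (P m) (Q n) = if m = n then h n else 0
  ne_zero : ∀ n, h n ≠ 0

theorem IsToeplitz.flip {B : ℂ[X] →ₗ[ℂ] ℂ[X] →ₗ[ℂ] ℂ} (hB : IsToeplitz B) :
    IsToeplitz B.flip := fun p q => hB q p

theorem IsToeplitz.pow_mul {B : ℂ[X] →ₗ[ℂ] ℂ[X] →ₗ[ℂ] ℂ} (hB : IsToeplitz B) (k : ℕ)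
    (p q : ℂ[X]) : B (X ^ k * p) (X ^ k * q) = B p q := by
  induction k with
  | zero => simp
  | succ k ih => rw [pow_succ', mul_assoc, mul_assoc, hB, ih]

theorem IsToeplitz.X_pow_swap {B : ℂ[X] →ₗ[ℂ] ℂ[X] →ₗ[ℂ] ℂ} (hB : IsToeplitz B) {n i j : ℕ}
    (hi : i ≤ n) (hj : j ≤ n) : B (X ^ (n - i)) (X ^ j) = B (X ^ (n - j)) (X ^ i) := by
  wlog hij : i ≤ j generalizing i j
  · exact (this hj hi (by omega)).symm
  have h1 : n - i = (j - i) + (n - j) := by omega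
  have h2 : (X : ℂ[X]) ^ j = X ^ (j - i) * X ^ i := by rw [← pow_add]; congr 1; omega
  rw [h1, h2, pow_add, hB.pow_mul]

theorem eq_sum_of_coeff_eq_zero {p : ℂ[X]} {n : ℕ} (hp : ∀ m, n < m → p.coeff m = 0) :
    p = ∑ i ∈ Finset.range (n + 1), p.coeff i • (X : ℂ[X]) ^ i := by
  ext m
  simp only [finsetSum_coeff, coeff_smul, coeff_X_pow, smul_eq_mul, mul_ite, mul_one, mul_zero,
    Finset.sum_ite_eq, Finset.mem_range]
  split_ifs with h
  · rfl
  · exact hp m (by omega)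

theorem reflect_eq_sum_of_coeff_eq_zero {p : ℂ[X]} {n : ℕ} (hp : ∀ m, n < m → p.coeff m = 0) :
    reflect n p = ∑ i ∈ Finset.range (n + 1), p.coeff i • (X : ℂ[X]) ^ (n - i) := by
  ext m
  simp only [finsetSum_coeff, coeff_smul, coeff_X_pow, smul_eq_mul, mul_ite, mul_one, mul_zero,
    coeff_reflect]
  rcases le_or_gt m n with h | h
  · rw [revAt_le h, Finset.sum_eq_single (n - m)]
    · rw [if_pos (by omega)]
    · intro b hb hbm
      rw [Finset.mem_range] at hb
      rw [if_neg (by omega)]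
    · intro hb
      simp only [Finset.mem_range] at hb
      omega
  · rw [revAt_eq_self_of_lt h, hp m h, Finset.sum_eq_zero]
    intro i _
    rw [if_neg (by omega)]

theorem coeff_reflect_of_lt {p : ℂ[X]} {n : ℕ} (hp : ∀ m, n < m → p.coeff m = 0) (m : ℕ)
    (hm : n < m) : (reflect n p).coeff m = 0 := by
  rw [coeff_reflect, revAt_eq_self_of_lt hm, hp m hm]

/-- A Toeplitz matrix is symmetric about its antidiagonal. This is what makes pairings with reversed
polynomials computable. -/
theorem IsToeplitz.reflect_swap {B : ℂ[X] →ₗ[ℂ] ℂ[X] →ₗ[ℂ] ℂ} (hB : IsToeplitz B) {n : ℕ}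
    {p q : ℂ[X]} (hp : ∀ m, n < m → p.coeff m = 0) (hq : ∀ m, n < m → q.coeff m = 0) :
    B (reflect n p) q = B (reflect n q) p := by
  rw [reflect_eq_sum_of_coeff_eq_zero hp, reflect_eq_sum_of_coeff_eq_zero hq]
  conv_lhs => rw [eq_sum_of_coeff_eq_zero hq]
  conv_rhs => rw [eq_sum_of_coeff_eq_zero hp]
  simp only [map_sum, map_smul, LinearMap.sum_apply, LinearMap.smul_apply, smul_eq_mul,
    Finset.mul_sum]
  rw [Finset.sum_comm]
  refine Finset.sum_congr rfl fun j hj => Finset.sum_congr rfl fun i hi => ?_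
  rw [Finset.mem_range] at hi hj
  rw [hB.X_pow_swap (show i ≤ n by omega) (show j ≤ n by omega)]
  ring

theorem IsToeplitz.reflect_swap' {B : ℂ[X] →ₗ[ℂ] ℂ[X] →ₗ[ℂ] ℂ} (hB : IsToeplitz B) {n : ℕ}
    {p q : ℂ[X]} (hp : ∀ m, n < m → p.coeff m = 0) (hq : ∀ m, n < m → q.coeff m = 0) :
    B p (reflect n q) = B q (reflect n p) :=
  hB.flip.reflect_swap hq hp

namespace IsMonicBiorthogonal

variable {B : ℂ[X] →ₗ[ℂ] ℂ[X] →ₗ[ℂ] ℂ} {P Q : ℕ → ℂ[X]} {h : ℕ → ℂ}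

theorem flip (H : IsMonicBiorthogonal B P Q h) : IsMonicBiorthogonal B.flip Q P h where
  coeff_left := H.coeff_right
  coeff_right := H.coeff_left
  coeff_left_of_lt := H.coeff_right_of_lt
  coeff_right_of_lt := H.coeff_left_of_lt
  orth m n := by
    rw [LinearMap.flip_apply, H.orth]
    by_cases hmn : m = n
    · subst hmn; rfl
    · rw [if_neg hmn, if_neg (Ne.symm hmn)]
  ne_zero := H.ne_zero

theorem apply_eq_zero (H : IsMonicBiorthogonal B P Q h) {n k : ℕ} (hk : k ≤ n) {p : ℂ[X]}
    (hp : ∀ m, k ≤ m → p.coeff m = 0) : B p (Q n) = 0 := by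
  induction k generalizing p with
  | zero =>
    have : p = 0 := by ext m; simpa using hp m (Nat.zero_le m)
    rw [this]; simp
  | succ k ih =>
    have h1 : B (p - p.coeff k • P k) (Q n) = 0 := by
      refine ih (by omega) fun m hm => ?_
      rcases hm.eq_or_lt with rfl | hm
      · simp [H.coeff_left]
      · simp [H.coeff_left_of_lt _ _ hm, hp m hm]
    rw [map_sub, map_smul, LinearMap.sub_apply, LinearMap.smul_apply, H.orth,
      if_neg (by omega)] at h1
    simpa using h1

theorem apply_eq (H : IsMonicBiorthogonal B P Q h) {n : ℕ} {p : ℂ[X]}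
    (hp : ∀ m, n < m → p.coeff m = 0) : B p (Q n) = p.coeff n * h n := by
  have h1 : B (p - p.coeff n • P n) (Q n) = 0 := by
    refine H.apply_eq_zero le_rfl fun m hm => ?_
    rcases hm.eq_or_lt with rfl | hm
    · simp [H.coeff_left]
    · simp [H.coeff_left_of_lt _ _ hm, hp m hm]
  rw [map_sub, map_smul, LinearMap.sub_apply, LinearMap.smul_apply, H.orth,
    if_pos rfl, sub_eq_zero] at h1
  simpa using h1

/-- One degree above n, subtracting a multiple of `P (n + 1)`, which is orthogonal to `Q n`, reduces
to `apply_eq`. -/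
theorem apply_eq_succ (H : IsMonicBiorthogonal B P Q h) {n : ℕ} {p : ℂ[X]}
    (hp : ∀ m, n + 1 < m → p.coeff m = 0) :
    B p (Q n) = (p.coeff n - p.coeff (n + 1) * (P (n + 1)).coeff n) * h n := by
  have h1 := H.apply_eq (n := n) (p := p - p.coeff (n + 1) • P (n + 1)) fun m hm => by
    rcases (Nat.succ_le_of_lt hm).eq_or_lt with rfl | hm
    · simp [H.coeff_left]
    · simp [H.coeff_left_of_lt _ _ hm, hp m hm]
  rw [map_sub, map_smul, LinearMap.sub_apply, LinearMap.smul_apply, H.orth,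
    if_neg (by omega)] at h1
  simpa using h1

theorem apply_eq_zero' (H : IsMonicBiorthogonal B P Q h) {n : ℕ} {q : ℂ[X]}
    (hq : ∀ m, n ≤ m → q.coeff m = 0) : B (P n) q = 0 :=
  H.flip.apply_eq_zero le_rfl hq

theorem apply_eq' (H : IsMonicBiorthogonal B P Q h) {n : ℕ} {q : ℂ[X]}
    (hq : ∀ m, n < m → q.coeff m = 0) : B (P n) q = q.coeff n * h n :=
  H.flip.apply_eq hq

theorem apply_eq_succ' (H : IsMonicBiorthogonal B P Q h) {n : ℕ} {q : ℂ[X]}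
    (hq : ∀ m, n + 1 < m → q.coeff m = 0) :
    B (P n) q = (q.coeff n - q.coeff (n + 1) * (Q (n + 1)).coeff n) * h n :=
  H.flip.apply_eq_succ hq

/-- Non-degeneracy on each space of bounded degree: pairing with the top `Q` detects the leading
coefficient because `h` never vanishes. -/
theorem eq_zero_of_forall (H : IsMonicBiorthogonal B P Q h) {n : ℕ} {p : ℂ[X]}
    (hp : ∀ m, n ≤ m → p.coeff m = 0) (h0 : ∀ k, k < n → B p (Q k) = 0) : p = 0 := by
  induction n with
  | zero => ext m; simpa using hp m (Nat.zero_le m)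
  | succ n ih =>
    have h1 := H.apply_eq (n := n) fun m hm => hp m hm
    rw [h0 n (by omega), eq_comm, mul_eq_zero, or_iff_left (H.ne_zero n)] at h1
    refine ih (fun m hm => ?_) fun k hk => h0 k (by omega)
    rcases hm.eq_or_lt with rfl | hm
    · exact h1
    · exact hp m hm

/-- The Szegő recurrence. -/
theorem szego (H : IsMonicBiorthogonal B P Q h) (hB : IsToeplitz B) (n : ℕ) :
    P (n + 1) = X * P n + (P (n + 1)).coeff 0 • reflect n (Q n) := by
  have hQ := H.coeff_right_of_lt n
  set p := P (n + 1) - X * P n - (P (n + 1)).coeff 0 • reflect n (Q n) with hp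
  -- The constant term of `p` is zero, so `p = X * divX p`, and `B (divX p) (Q k) = B p (X * Q k)`.
  -- Each of the three pieces of `p` is orthogonal to `X * Q k` for `k < n`; the reversed one
  -- because it only sees the constant term of `X * Q k`.
  suffices hX : divX p = 0 by
    have h0 : p.coeff 0 = 0 := by
      simp [hp, coeff_reflect, H.coeff_right]
    have := divX_mul_X_add p
    rw [hX, h0] at this
    have hp0 : p = 0 := by simpa using this.symm
    rw [hp] at hp0
    linear_combination hp0
  have hpX : p = X * divX p := by
    have h0 : p.coeff 0 = 0 := by
      simp [hp, coeff_reflect, H.coeff_right]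
    conv_lhs => rw [← divX_mul_X_add p, h0]
    simp [mul_comm]
  refine H.eq_zero_of_forall (n := n) (fun m hm => ?_) fun k hk => ?_
  · rw [coeff_divX, hp, coeff_sub, coeff_sub, coeff_X_mul, coeff_smul,
      coeff_reflect_of_lt hQ _ (by omega)]
    rcases hm.eq_or_lt with rfl | hm
    · simp [H.coeff_left]
    · simp [H.coeff_left_of_lt _ _ hm, H.coeff_left_of_lt (n + 1) (m + 1) (by omega)]
  · have hXQ : ∀ m, k + 1 < m → (X * Q k).coeff m = 0 := fun m hm => by
      obtain ⟨m, rfl⟩ : ∃ a, m = a + 1 := ⟨m - 1, by omega⟩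
      rw [coeff_X_mul, H.coeff_right_of_lt _ _ (by omega)]
    rw [← hB, ← hpX, hp, map_sub, map_sub, map_smul, LinearMap.sub_apply, LinearMap.sub_apply,
      LinearMap.smul_apply, hB, H.orth, if_neg (by omega),
      H.apply_eq_zero' (fun m hm => hXQ m (by omega)),
      hB.reflect_swap hQ (fun m hm => hXQ m (by omega)),
      H.apply_eq (coeff_reflect_of_lt fun m hm => hXQ m (by omega)), coeff_reflect]
    simp

theorem szego' (H : IsMonicBiorthogonal B P Q h) (hB : IsToeplitz B) (n : ℕ) :
    Q (n + 1) = X * Q n + (Q (n + 1)).coeff 0 • reflect n (P n) :=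
  H.flip.szego hB.flip n

theorem coeff_succ_self (H : IsMonicBiorthogonal B P Q h) (hB : IsToeplitz B) (n : ℕ) :
    (P (n + 2)).coeff (n + 1)
      = (P (n + 1)).coeff n + (P (n + 2)).coeff 0 * (Q (n + 1)).coeff 0 := by
  conv_lhs => rw [H.szego hB (n + 1)]
  simp [coeff_reflect]

theorem coeff_one_zero (H : IsMonicBiorthogonal B P Q h) (hB : IsToeplitz B) (n : ℕ) :
    (P (n + 2)).coeff 1
      = (P (n + 1)).coeff 0 + (P (n + 2)).coeff 0 * (Q (n + 1)).coeff n := by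
  conv_lhs => rw [H.szego hB (n + 1)]
  have h1 : (X * P (n + 1)).coeff 1 = (P (n + 1)).coeff 0 := coeff_X_mul _ 0
  rw [coeff_add, h1, coeff_smul, coeff_reflect, revAt_le (by omega), Nat.add_sub_cancel,
    smul_eq_mul]

theorem norm_succ (H : IsMonicBiorthogonal B P Q h) (hB : IsToeplitz B) (n : ℕ) :
    h (n + 1) = (1 - (P (n + 1)).coeff 0 * (Q (n + 1)).coeff 0) * h n := by
  have hQ := H.coeff_right_of_lt n
  have h1 := H.orth n n
  have hXQ : ∀ m, n + 1 < m → (X * Q n).coeff m = 0 := fun m hm => by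
    obtain ⟨m, rfl⟩ : ∃ a, m = a + 1 := ⟨m - 1, by omega⟩
    rw [coeff_X_mul, hQ _ (by omega)]
  -- The pairing of `reflect n (Q n)` with `reflect n (P n)` is again `h n`, since reversal swaps
  -- the two arguments.
  have h2 : B (reflect n (Q n)) (X * Q n) = - (Q (n + 1)).coeff 0 * h n := by
    have h3 : X * Q n = Q (n + 1) - (Q (n + 1)).coeff 0 • reflect n (P n) :=
      eq_sub_of_add_eq (H.szego' hB n).symm
    have hr : reflect n (reflect n (P n)) = P n := by simp
    rw [h3, map_sub, map_smul, H.apply_eq_zero le_rfl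
      (fun m hm => coeff_reflect_of_lt hQ m hm), hB.reflect_swap hQ
      (coeff_reflect_of_lt (H.coeff_left_of_lt n)), hr, h1, if_pos rfl]
    simp
  rw [if_pos rfl, ← hB, show X * P n = P (n + 1) - (P (n + 1)).coeff 0 • reflect n (Q n) from
    eq_sub_of_add_eq (H.szego hB n).symm, map_sub, map_smul, LinearMap.sub_apply,
    LinearMap.smul_apply, h2, H.apply_eq' hXQ,
    coeff_X_mul, H.coeff_right] at h1
  simp only [smul_eq_mul] at h1
  linear_combination h1

end IsMonicBiorthogonal
end PVWeight
end

/-! ### From integration by parts to the recurrences. -/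

noncomputable section

namespace PVWeight

open Polynomial

/-- The integration by parts identity for the bilinear form of the weight
`(1+z)^μ (1+1/z)^ν e^{tz}`. -/
def IsSemiclassical (μ ν t : ℂ) (B : ℂ[X] →ₗ[ℂ] ℂ[X] →ₗ[ℂ] ℂ) : Prop :=
  ∀ p q, B (X * derivative p) (X * q) + B (X * derivative p) q
    - B p (X * (q + X * derivative q)) - B p (q + X * derivative q)
    + t * B (X * p) q + (1 + μ + t) * B p q - ν * B p (X * q) = 0

theorem coeff_X_mul_derivative (p : ℂ[X]) (m : ℕ) :
    (X * derivative p).coeff m = m * p.coeff m := by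
  cases m with
  | zero => simp
  | succ m => rw [coeff_X_mul, coeff_derivative]; push_cast; ring

theorem coeff_X_mul_eq_zero {p : ℂ[X]} {n : ℕ} (hp : ∀ m, n < m → p.coeff m = 0) (m : ℕ)
    (hm : n + 1 < m) : (X * p).coeff m = 0 := by
  obtain ⟨m, rfl⟩ : ∃ a, m = a + 1 := ⟨m - 1, by omega⟩
  rw [coeff_X_mul, hp _ (by omega)]

theorem coeff_X_mul_derivative_eq_zero {p : ℂ[X]} {n : ℕ} (hp : ∀ m, n < m → p.coeff m = 0)
    (m : ℕ) (hm : n < m) : (X * derivative p).coeff m = 0 := by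
  rw [coeff_X_mul_derivative, hp m hm, mul_zero]

theorem coeff_add_X_mul_derivative (p : ℂ[X]) (m : ℕ) :
    (p + X * derivative p).coeff m = (m + 1) * p.coeff m := by
  rw [coeff_add, coeff_X_mul_derivative]; ring

theorem coeff_add_X_mul_derivative_eq_zero {p : ℂ[X]} {n : ℕ}
    (hp : ∀ m, n < m → p.coeff m = 0) (m : ℕ) (hm : n < m) :
    (p + X * derivative p).coeff m = 0 := by
  rw [coeff_add_X_mul_derivative, hp m hm, mul_zero]

namespace IsMonicBiorthogonal

variable {B : ℂ[X] →ₗ[ℂ] ℂ[X] →ₗ[ℂ] ℂ} {P Q : ℕ → ℂ[X]} {h : ℕ → ℂ} {μ ν t : ℂ}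

/-- Integration by parts tested on the pair (P_{n+1}, Q_{n+1}). -/
theorem subleading_relation (H : IsMonicBiorthogonal B P Q h) (hB : IsToeplitz B)
    (hS : IsSemiclassical μ ν t B) (n : ℕ) :
    (n + 2 + ν) * (Q (n + 2)).coeff (n + 1) - (n + 1 + ν) * (Q (n + 1)).coeff n
      + t * ((P (n + 1)).coeff n - (P (n + 2)).coeff (n + 1)) + μ + t = 0 := by
  have hP := H.coeff_left_of_lt (n + 1)
  have hQ := H.coeff_right_of_lt (n + 1)
  have e := hS (P (n + 1)) (Q (n + 1))
  rw [hB, H.apply_eq_zero le_rfl (p := derivative _)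
      (fun m hm => by rw [coeff_derivative, hP _ (by omega), zero_mul]),
    H.apply_eq (coeff_X_mul_derivative_eq_zero hP),
    H.apply_eq_succ' (coeff_X_mul_eq_zero (coeff_add_X_mul_derivative_eq_zero hQ)),
    H.apply_eq' (coeff_add_X_mul_derivative_eq_zero hQ),
    H.apply_eq_succ (coeff_X_mul_eq_zero hP), H.apply_eq hP,
    H.apply_eq_succ' (coeff_X_mul_eq_zero hQ)] at e
  simp only [coeff_X_mul, coeff_add_X_mul_derivative, coeff_derivative, H.coeff_left,
    H.coeff_right] at e
  push_cast at e
  refine mul_right_cancel₀ (H.ne_zero (n + 1)) ?_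
  linear_combination e

theorem subleading_relation_zero (H : IsMonicBiorthogonal B P Q h) (hB : IsToeplitz B)
    (hS : IsSemiclassical μ ν t B) :
    (1 + ν) * (Q 1).coeff 0 - t * (P 1).coeff 0 + μ + t = 0 := by
  have hP := H.coeff_left_of_lt 0
  have hQ := H.coeff_right_of_lt 0
  have e := hS (P 0) (Q 0)
  rw [hB, H.apply_eq_zero le_rfl (p := derivative _)
      (fun m hm => by rw [coeff_derivative, hP _ (by omega), zero_mul]),
    H.apply_eq (coeff_X_mul_derivative_eq_zero hP),
    H.apply_eq_succ' (coeff_X_mul_eq_zero (coeff_add_X_mul_derivative_eq_zero hQ)),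
    H.apply_eq' (coeff_add_X_mul_derivative_eq_zero hQ),
    H.apply_eq_succ (coeff_X_mul_eq_zero hP), H.apply_eq hP,
    H.apply_eq_succ' (coeff_X_mul_eq_zero hQ)] at e
  simp only [coeff_X_mul, coeff_add_X_mul_derivative, H.coeff_left,
    H.coeff_right, mul_coeff_zero, coeff_X_zero] at e
  push_cast at e
  refine mul_right_cancel₀ (H.ne_zero 0) ?_
  linear_combination e

/-- Integration by parts tested on P_{n+1} and its reversal. The term with `X * P (n + 1)` is
evaluated by the Szegő recurrence. -/
theorem left_relation (H : IsMonicBiorthogonal B P Q h) (hB : IsToeplitz B)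
    (hS : IsSemiclassical μ ν t B) (n : ℕ) :
    (n + 2 + ν) * ((P (n + 1)).coeff 0 * (Q (n + 2)).coeff (n + 1))
      - (n + ν) * (P (n + 1)).coeff 1 + (μ + t - (n + 1)) * (P (n + 1)).coeff 0
      - t * (P (n + 2)).coeff 0 = 0 := by
  have hP := H.coeff_left_of_lt (n + 1)
  have hQ := H.coeff_right_of_lt (n + 1)
  have hR := coeff_reflect_of_lt hP
  have hR0 : (reflect (n + 1) (P (n + 1))).coeff n = (P (n + 1)).coeff 1 := by
    rw [coeff_reflect, revAt_le (by omega), show n + 1 - n = 1 by omega]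
  have hR1 : (reflect (n + 1) (P (n + 1))).coeff (n + 1) = (P (n + 1)).coeff 0 := by
    rw [coeff_reflect, revAt_le (by omega), Nat.sub_self]
  have hd : ∀ m, n + 1 < m → (derivative (P (n + 1))).coeff m = 0 := fun m hm => by
    rw [coeff_derivative, hP _ (by omega), zero_mul]
  have hr : reflect (n + 1) (reflect (n + 1) (Q (n + 1))) = Q (n + 1) := by simp
  have hXP : X * P (n + 1)
      = P (n + 2) - (P (n + 2)).coeff 0 • reflect (n + 1) (Q (n + 1)) :=
    eq_sub_of_add_eq (H.szego hB (n + 1)).symm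
  have e := hS (P (n + 1)) (reflect (n + 1) (P (n + 1)))
  rw [hB, hB.reflect_swap' hd hP, hB.reflect_swap' (coeff_X_mul_derivative_eq_zero hP) hP,
    H.apply_eq' (coeff_reflect_of_lt hd),
    H.apply_eq' (coeff_reflect_of_lt (coeff_X_mul_derivative_eq_zero hP)),
    H.apply_eq_succ' (coeff_X_mul_eq_zero (coeff_add_X_mul_derivative_eq_zero hR)),
    H.apply_eq' (coeff_add_X_mul_derivative_eq_zero hR), hXP, map_sub, map_smul,
    LinearMap.sub_apply, LinearMap.smul_apply, H.apply_eq_zero' (fun m hm => hR m hm),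
    hB.reflect_swap' (coeff_reflect_of_lt hQ) hP, hr, H.orth, if_pos rfl,
    H.apply_eq' hR, H.apply_eq_succ' (coeff_X_mul_eq_zero hR)] at e
  simp only [coeff_X_mul, coeff_add_X_mul_derivative, coeff_X_mul_derivative, hR0, hR1,
    coeff_reflect, revAt_le le_rfl, Nat.sub_self, coeff_derivative, smul_eq_mul, zero_add] at e
  push_cast at e
  refine mul_right_cancel₀ (H.ne_zero (n + 1)) ?_
  linear_combination e

/-- Integration by parts tested on the reversal of Q_{n+1} and Q_{n+1} itself. It is not the `flip`
of `left_relation`: the factor e^{tz} breaks the symmetry z ↔ 1/z. -/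
theorem right_relation (H : IsMonicBiorthogonal B P Q h) (hB : IsToeplitz B)
    (hS : IsSemiclassical μ ν t B) (n : ℕ) :
    (n + 2 + ν) * (Q (n + 2)).coeff 0 + (n + 1 + μ + t) * (Q (n + 1)).coeff 0
      + t * ((Q (n + 1)).coeff 1 - (Q (n + 1)).coeff 0 * (P (n + 2)).coeff (n + 1)) = 0 := by
  have hP := H.coeff_left_of_lt (n + 1)
  have hQ := H.coeff_right_of_lt (n + 1)
  have hR := coeff_reflect_of_lt hQ
  have hR0 : (reflect (n + 1) (Q (n + 1))).coeff n = (Q (n + 1)).coeff 1 := by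
    rw [coeff_reflect, revAt_le (by omega), show n + 1 - n = 1 by omega]
  have hR1 : (reflect (n + 1) (Q (n + 1))).coeff (n + 1) = (Q (n + 1)).coeff 0 := by
    rw [coeff_reflect, revAt_le (by omega), Nat.sub_self]
  -- The reversal of Q_{n+1} is orthogonal to X, ..., X^{n+1}, so it reads off the constant term. In
  -- degree n+2 a multiple of Q_{n+2} is subtracted first.
  have hlow : ∀ q : ℂ[X], (∀ m, n + 1 < m → q.coeff m = 0) →
      B (reflect (n + 1) (Q (n + 1))) q = q.coeff 0 * h (n + 1) := fun q hq => by
    rw [hB.reflect_swap hQ hq, H.apply_eq (coeff_reflect_of_lt hq), coeff_reflect,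
      revAt_le le_rfl, Nat.sub_self]
  have hhigh : ∀ q : ℂ[X], (∀ m, n + 2 < m → q.coeff m = 0) →
      B (reflect (n + 1) (Q (n + 1))) q
        = (q.coeff 0 - q.coeff (n + 2) * (Q (n + 2)).coeff 0) * h (n + 1) := fun q hq => by
    have h1 := hlow (q - q.coeff (n + 2) • Q (n + 2)) fun m hm => by
      rcases (Nat.succ_le_of_lt hm).eq_or_lt with rfl | hm
      · simp [H.coeff_right]
      · simp [H.coeff_right_of_lt _ _ hm, hq m hm]
    rw [map_sub, map_smul, H.apply_eq_zero le_rfl (fun m hm => hR m hm)] at h1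
    simpa using h1
  have e := hS (reflect (n + 1) (Q (n + 1))) (Q (n + 1))
  rw [hB, H.apply_eq_zero le_rfl (p := derivative _)
      (fun m hm => by rw [coeff_derivative, hR _ (by omega), zero_mul]),
    H.apply_eq (coeff_X_mul_derivative_eq_zero hR),
    hhigh _ (coeff_X_mul_eq_zero (coeff_add_X_mul_derivative_eq_zero hQ)),
    hlow _ (coeff_add_X_mul_derivative_eq_zero hQ),
    H.apply_eq_succ (coeff_X_mul_eq_zero hR), H.apply_eq hR,
    hhigh _ (coeff_X_mul_eq_zero hQ)] at e
  simp only [coeff_X_mul, coeff_add_X_mul_derivative, coeff_derivative,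
    H.coeff_right, hR0, hR1, mul_coeff_zero, coeff_X_zero] at e
  push_cast at e
  refine mul_right_cancel₀ (H.ne_zero (n + 1)) ?_
  linear_combination e

/-- The three-term recurrence for `r̄`. -/
theorem right_recurrence (H : IsMonicBiorthogonal B P Q h) (hB : IsToeplitz B)
    (hS : IsSemiclassical μ ν t B) (n : ℕ) :
    (n + 2 + ν) * (Q (n + 2)).coeff 0 + (n + 1 + μ + t) * (Q (n + 1)).coeff 0
      + t * (1 - (P (n + 1)).coeff 0 * (Q (n + 1)).coeff 0) * (Q n).coeff 0
      - t * (P (n + 2)).coeff 0 * (Q (n + 1)).coeff 0 ^ 2 = 0 := by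
  have e := H.right_relation hB hS n
  have h1 := H.coeff_succ_self hB n
  cases n with
  | zero =>
    simp only [zero_add, H.coeff_right, CharP.cast_eq_zero] at *
    linear_combination e + t * (Q 1).coeff 0 * h1
  | succ n =>
    have h2 := H.coeff_succ_self hB n
    have h3 := H.flip.coeff_one_zero hB.flip n
    linear_combination e + t * (Q (n + 2)).coeff 0 * (h1 + h2) - t * h3

/-- The three-term recurrence for `r`. -/
theorem left_recurrence (H : IsMonicBiorthogonal B P Q h) (hB : IsToeplitz B)
    (hS : IsSemiclassical μ ν t B) (n : ℕ) :
    t * (P (n + 2)).coeff 0 * (1 - (P (n + 1)).coeff 0 * (Q (n + 1)).coeff 0)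
      = t * (P (n + 1)).coeff 0 ^ 2 * (Q n).coeff 0
        - (μ + t + (n + 1)) * (P (n + 1)).coeff 0 - (n + ν) * (P n).coeff 0 := by
  have hne : 1 - (P (n + 1)).coeff 0 * (Q (n + 1)).coeff 0 ≠ 0 := fun h0 =>
    H.ne_zero (n + 1) (by rw [H.norm_succ hB, h0, zero_mul])
  have eA := H.subleading_relation hB hS n
  have eB := H.left_relation hB hS n
  have eC := H.right_recurrence hB hS n
  have h1 := H.coeff_succ_self hB n
  have h2 := H.flip.coeff_succ_self hB.flip n
  have hm : (P (n + 1)).coeff 1 = (P n).coeff 0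
      + (P (n + 1)).coeff 0 * ((Q (n + 1)).coeff n - (Q (n + 1)).coeff 0 * (P n).coeff 0) := by
    cases n with
    | zero => simp [H.coeff_left]
    | succ n =>
      linear_combination H.coeff_one_zero hB n
        - (P (n + 2)).coeff 0 * H.flip.coeff_succ_self hB.flip n
  refine mul_left_cancel₀ hne ?_
  -- After the Szegő substitutions the subleading coefficient of Q_{n+1} enters `eB` with factor
  -- 2r_{n+1} and `eA` with factor 1, hence the multiplier of `eA`; r_{n+1}² times `eC` then removes
  -- r̄_{n+2}. What is left is the claim times 1 - r_{n+1} r̄_{n+1}, a ratio of norms and so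
  -- non-zero.
  linear_combination -(eB - (n + 2 + ν) * (P (n + 1)).coeff 0 * h2 + (n + ν) * hm)
    + 2 * (P (n + 1)).coeff 0 * (eA - (n + 2 + ν) * h2 + t * h1)
    - (P (n + 1)).coeff 0 ^ 2 * eC

/-- The left side is conserved: its increment in n is a combination of the two three-term
recurrences. At n = 0 it factors as -(ν + t r_1) times the left side of `subleading_relation_zero`.
-/
theorem quadratic_relation (H : IsMonicBiorthogonal B P Q h) (hB : IsToeplitz B)
    (hS : IsSemiclassical μ ν t B) (n : ℕ) :
    t ^ 2 * (P (n + 1)).coeff 0 ^ 2 * (Q n).coeff 0 ^ 2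
      + t * (ν - μ - t) * ((P (n + 1)).coeff 0 * (Q n).coeff 0)
      - (n + 1 + ν) * (n + ν) * ((Q (n + 1)).coeff 0 * (P n).coeff 0)
      - (n + ν) * t * ((P n).coeff 0 * (Q n).coeff 0)
      - (n + 1 + ν) * t * ((P (n + 1)).coeff 0 * (Q (n + 1)).coeff 0) - μ * ν = 0 := by
  induction n with
  | zero =>
    have e := H.subleading_relation_zero hB hS
    simp only [H.coeff_left, H.coeff_right, zero_add, CharP.cast_eq_zero]
    linear_combination (-ν - t * (P 1).coeff 0) * e
  | succ n ih =>
    have eC := H.right_recurrence hB hS n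
    have eD := H.left_recurrence hB hS n
    push_cast
    linear_combination ih
      - ((n + 1 + ν) * (P (n + 1)).coeff 0 + t * (P (n + 2)).coeff 0) * eC
      + ((n + 1 + ν) * (Q (n + 1)).coeff 0 + t * (Q n).coeff 0) * eD

theorem product_relation (H : IsMonicBiorthogonal B P Q h) (hB : IsToeplitz B)
    (hS : IsSemiclassical μ ν t B) (n : ℕ) :
    (1 - (P (n + 1)).coeff 0 * (Q (n + 1)).coeff 0)
        * (t * (P (n + 2)).coeff 0 + (n + 1 + ν) * (P (n + 1)).coeff 0)
        * (t * (Q n).coeff 0 + (n + 1 + ν) * (Q (n + 1)).coeff 0)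
      = ((n + 1 + ν) * ((P (n + 1)).coeff 0 * (Q (n + 1)).coeff 0) + μ)
        * (ν - (n + 1 + ν) * ((P (n + 1)).coeff 0 * (Q (n + 1)).coeff 0)) := by
  linear_combination H.quadratic_relation hB hS n
    + (t * (Q n).coeff 0 + (n + 1 + ν) * (Q (n + 1)).coeff 0) * H.left_recurrence hB hS n

end IsMonicBiorthogonal
end PVWeight
end

/-! ### Analysis of the weight on the circle. -/

noncomputable section

namespace PVWeight

open Polynomial MeasureTheory Filter Topology Set

theorem cos_half_pos {θ : ℝ} (hθ : θ ∈ Ioo (-Real.pi) Real.pi) : 0 < Real.cos (θ / 2) :=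
  Real.cos_pos_of_mem_Ioo ⟨by linarith [hθ.1], by linarith [hθ.2]⟩

theorem one_add_cos_eq (θ : ℝ) : 1 + Real.cos θ = 2 * Real.cos (θ / 2) ^ 2 := by
  rw [Real.cos_sq, mul_div_cancel₀ θ two_ne_zero]; ring

theorem one_div_exp_mul_I (θ : ℝ) :
    1 / Complex.exp (θ * Complex.I) = Complex.exp (((-θ : ℝ) : ℂ) * Complex.I) := by
  rw [one_div, ← Complex.exp_neg]; push_cast; ring_nf

theorem one_add_exp_mem_slitPlane {θ : ℝ} (hθ : θ ∈ Ioo (-Real.pi) Real.pi) :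
    1 + Complex.exp (θ * Complex.I) ∈ Complex.slitPlane := by
  refine Or.inl ?_
  rw [Complex.add_re, Complex.one_re, Complex.exp_ofReal_mul_I_re, one_add_cos_eq]
  have := cos_half_pos hθ
  positivity

theorem one_add_inv_exp_mem_slitPlane {θ : ℝ} (hθ : θ ∈ Ioo (-Real.pi) Real.pi) :
    1 + 1 / Complex.exp (θ * Complex.I) ∈ Complex.slitPlane := by
  rw [one_div_exp_mul_I]
  exact one_add_exp_mem_slitPlane ⟨by linarith [hθ.2], by linarith [hθ.1]⟩

theorem norm_one_add_exp {θ : ℝ} (hθ : θ ∈ Ioo (-Real.pi) Real.pi) :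
    ‖1 + Complex.exp (θ * Complex.I)‖ = 2 * Real.cos (θ / 2) := by
  have h1 : ‖1 + Complex.exp (θ * Complex.I)‖ ^ 2 = (2 * Real.cos (θ / 2)) ^ 2 := by
    rw [← Complex.normSq_eq_norm_sq, Complex.normSq_apply, Complex.add_re, Complex.add_im,
      Complex.one_re, Complex.one_im, Complex.exp_ofReal_mul_I_re, Complex.exp_ofReal_mul_I_im]
    linear_combination Real.sin_sq_add_cos_sq θ + 2 * one_add_cos_eq θ
  have h2 := cos_half_pos hθ
  exact (sq_eq_sq₀ (norm_nonneg _) (by positivity)).1 h1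

theorem norm_one_add_inv_exp {θ : ℝ} (hθ : θ ∈ Ioo (-Real.pi) Real.pi) :
    ‖1 + 1 / Complex.exp (θ * Complex.I)‖ = 2 * Real.cos (θ / 2) := by
  rw [one_div_exp_mul_I, norm_one_add_exp ⟨by linarith [hθ.2], by linarith [hθ.1]⟩, neg_div,
    Real.cos_neg]

theorem norm_cpow_le_mul_exp (z a : ℂ) :
    ‖z ^ a‖ ≤ ‖z‖ ^ a.re * Real.exp (Real.pi * |a.im|) := by
  refine (Complex.norm_cpow_le z a).trans ?_
  rw [div_eq_mul_inv, ← Real.exp_neg]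
  gcongr
  refine (neg_le_abs _).trans ?_
  rw [abs_mul]
  gcongr
  exact Complex.abs_arg_le_pi z

/-- A constant in the bound of the weight by a power of `|1+z|`. -/
def weightBound (μ ν t : ℂ) : ℝ :=
  Real.exp (Real.pi * |μ.im|) * Real.exp (Real.pi * |ν.im|) * Real.exp ‖t‖

theorem weightBound_nonneg (μ ν t : ℂ) : 0 ≤ weightBound μ ν t := by
  unfold weightBound; positivity

/-- On the circle 1+z and 1+1/z have the same modulus, so the exponents add up; the imaginary parts
contribute only bounded factors. -/
theorem norm_weight_le (μ ν t : ℂ) {θ : ℝ} (hθ : θ ∈ Ioo (-Real.pi) Real.pi) :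
    ‖weight μ ν t (Complex.exp (θ * Complex.I))‖
      ≤ weightBound μ ν t * (2 * Real.cos (θ / 2)) ^ (μ + ν).re := by
  have h2 := cos_half_pos hθ
  have hμ := norm_cpow_le_mul_exp (1 + Complex.exp (θ * Complex.I)) μ
  have hν := norm_cpow_le_mul_exp (1 + 1 / Complex.exp (θ * Complex.I)) ν
  have ht : ‖Complex.exp (t * Complex.exp (θ * Complex.I))‖ ≤ Real.exp ‖t‖ := by
    refine (Complex.norm_exp_le_exp_norm _).trans ?_
    rw [norm_mul, Complex.norm_exp_ofReal_mul_I, mul_one]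
  rw [norm_one_add_exp hθ] at hμ
  rw [norm_one_add_inv_exp hθ] at hν
  unfold weight
  rw [norm_mul, norm_mul]
  calc _ ≤ ((2 * Real.cos (θ / 2)) ^ μ.re * Real.exp (Real.pi * |μ.im|))
        * ((2 * Real.cos (θ / 2)) ^ ν.re * Real.exp (Real.pi * |ν.im|)) * Real.exp ‖t‖ := by
        gcongr
    _ = _ := by
        rw [Complex.add_re, Real.rpow_add (by positivity), weightBound]; ring

theorem hasDerivAt_exp_mul_I (θ : ℝ) :
    HasDerivAt (fun x : ℝ => Complex.exp (x * Complex.I))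
      (Complex.I * Complex.exp (θ * Complex.I)) θ := by
  have h := (((hasDerivAt_id (θ : ℂ)).mul_const Complex.I).cexp).comp_ofReal
  refine h.congr_deriv ?_
  simp only [id]
  ring

theorem hasDerivAt_inv_exp_mul_I (θ : ℝ) :
    HasDerivAt (fun x : ℝ => 1 / Complex.exp (x * Complex.I))
      (-Complex.I * (1 / Complex.exp (θ * Complex.I))) θ := by
  have h := (((hasDerivAt_id (θ : ℂ)).mul_const (-Complex.I)).cexp).comp_ofReal
  have e : ∀ x : ℂ, 1 / Complex.exp (x * Complex.I) = Complex.exp (x * -Complex.I) := fun x => by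
    rw [mul_neg, Complex.exp_neg, one_div]
  simp only [e]
  refine h.congr_deriv ?_
  simp only [id]
  ring

theorem hasDerivAt_weight (μ ν t : ℂ) {θ : ℝ} (hθ : θ ∈ Ioo (-Real.pi) Real.pi) :
    HasDerivAt (fun x : ℝ => weight μ ν t (Complex.exp (x * Complex.I)))
      (weight μ ν t (Complex.exp (θ * Complex.I)) * Complex.I *
        ((μ * Complex.exp (θ * Complex.I) - ν) / (1 + Complex.exp (θ * Complex.I))
          + t * Complex.exp (θ * Complex.I))) θ := by
  have hs1 := one_add_exp_mem_slitPlane hθ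
  have hs2 := one_add_inv_exp_mem_slitPlane hθ
  have hz := hasDerivAt_exp_mul_I θ
  have h1 := ((hasDerivAt_id _).cpow_const (c := μ) hs1).comp θ (hz.const_add 1)
  have h2 := ((hasDerivAt_id _).cpow_const (c := ν) hs2).comp θ
    ((hasDerivAt_inv_exp_mul_I θ).const_add 1)
  have h3 := (hz.const_mul t).cexp
  have hn0 := Complex.exp_ne_zero (θ * Complex.I)
  have hn1 := Complex.slitPlane_ne_zero hs1
  have hn2 := Complex.slitPlane_ne_zero hs2
  refine ((h1.mul h2).mul h3).congr_deriv ?_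
  simp only [Pi.mul_apply, Function.comp_apply, id]
  rw [Complex.cpow_sub _ _ hn1, Complex.cpow_sub _ _ hn2, Complex.cpow_one, Complex.cpow_one,
    weight]
  have e : 1 + 1 / Complex.exp (θ * Complex.I)
      = (1 + Complex.exp (θ * Complex.I)) / Complex.exp (θ * Complex.I) := by
    field_simp; ring
  -- The power is hidden before its base is rewritten as a quotient, over which a principal power
  -- need not split.
  generalize (1 + 1 / Complex.exp (θ * Complex.I)) ^ ν = b
  rw [e]
  generalize (1 + Complex.exp (θ * Complex.I)) ^ μ = a
  generalize Complex.exp (t * Complex.exp (θ * Complex.I)) = d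
  generalize Complex.exp (θ * Complex.I) = z at *
  field_simp
  ring

/-- Jordan's inequality for the sine; the factor 2 is slack. -/
theorem mul_pi_sub_le_cos_half {θ : ℝ} (h0 : 0 ≤ θ) (h1 : θ ≤ Real.pi) :
    (Real.pi - θ) / Real.pi ≤ 2 * Real.cos (θ / 2) := by
  have hp := Real.pi_pos
  have h := Real.mul_le_sin (x := (Real.pi - θ) / 2) (by linarith) (by linarith)
  have e : Real.sin ((Real.pi - θ) / 2) = Real.cos (θ / 2) := by
    rw [← Real.sin_pi_div_two_sub]; ring_nf
  rw [e] at h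
  have e2 : 2 / Real.pi * ((Real.pi - θ) / 2) = (Real.pi - θ) / Real.pi := by ring
  rw [e2] at h
  have : 0 ≤ (Real.pi - θ) / Real.pi := div_nonneg (by linarith) hp.le
  linarith

/-- One majorant for both signs of ρ: the constant covers ρ ≥ 0, the two powers cover the
singularities at ±π when ρ ≤ 0. -/
theorem rpow_cos_half_le {ρ θ : ℝ} (hθ : θ ∈ Ioo (-Real.pi) Real.pi) :
    (2 * Real.cos (θ / 2)) ^ ρ ≤ ((Real.pi - θ) / Real.pi) ^ ρ + ((Real.pi + θ) / Real.pi) ^ ρ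
      + 2 ^ ρ := by
  have hp := Real.pi_pos
  have hc := cos_half_pos hθ
  have ha : 0 < (Real.pi - θ) / Real.pi := div_pos (by linarith [hθ.2]) hp
  have hb : 0 < (Real.pi + θ) / Real.pi := div_pos (by linarith [hθ.1]) hp
  have ha' := Real.rpow_nonneg ha.le ρ
  have hb' := Real.rpow_nonneg hb.le ρ
  have h2 : (0 : ℝ) ≤ 2 ^ ρ := by positivity
  rcases le_total 0 ρ with hρ | hρ
  · have : (2 * Real.cos (θ / 2)) ^ ρ ≤ 2 ^ ρ :=
      Real.rpow_le_rpow (by positivity) (by linarith [Real.cos_le_one (θ / 2)]) hρ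
    linarith
  · rcases le_total 0 θ with h0 | h0
    · have := Real.rpow_le_rpow_of_nonpos ha (mul_pi_sub_le_cos_half h0 hθ.2.le) hρ
      linarith
    · have h := mul_pi_sub_le_cos_half (θ := -θ) (by linarith) (by linarith [hθ.1])
      rw [neg_div, Real.cos_neg, sub_neg_eq_add] at h
      have := Real.rpow_le_rpow_of_nonpos hb h hρ
      linarith

theorem intervalIntegrable_weight {μ ν : ℂ} (t : ℂ) (hμν : -1 < (μ + ν).re) :
    IntervalIntegrable (fun θ : ℝ => weight μ ν t (Complex.exp (θ * Complex.I))) volume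
      (-Real.pi) Real.pi := by
  have hp := Real.pi_pos
  set ρ := (μ + ν).re with hρ
  have hle : -Real.pi ≤ Real.pi := by linarith
  have h0 : IntervalIntegrable (fun x : ℝ => x ^ ρ) volume 0 2 :=
    intervalIntegral.intervalIntegrable_rpow' hμν
  have hB : IntervalIntegrable (fun θ : ℝ => ((Real.pi + θ) / Real.pi) ^ ρ) volume
      (-Real.pi) Real.pi := by
    have h := (h0.comp_mul_left (c := Real.pi⁻¹)).comp_add_left Real.pi
    have e : 2 * Real.pi - Real.pi = Real.pi := by ring
    simpa only [div_inv_eq_mul, zero_mul, zero_sub, e, inv_mul_eq_div] using h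
  have hA : IntervalIntegrable (fun θ : ℝ => ((Real.pi - θ) / Real.pi) ^ ρ) volume
      (-Real.pi) Real.pi := by
    simpa only [zero_sub, neg_neg, sub_neg_eq_add, ← sub_eq_add_neg, zero_add] using
      (hB.comp_sub_left 0).symm
  have hg := (((hA.add hB).add (intervalIntegrable_const (c := (2 : ℝ) ^ ρ))).const_mul
    (weightBound μ ν t))
  rw [intervalIntegrable_iff_integrableOn_Ioo_of_le hle] at hg ⊢
  refine Integrable.mono' hg ?_ ?_
  · refine ContinuousOn.aestronglyMeasurable (fun θ hθ => ?_) measurableSet_Ioo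
    exact (hasDerivAt_weight μ ν t hθ).continuousAt.continuousWithinAt
  · refine (ae_restrict_iff' measurableSet_Ioo).2 (ae_of_all _ fun θ hθ => ?_)
    exact (norm_weight_le μ ν t hθ).trans
      (mul_le_mul_of_nonneg_left (rpow_cos_half_le hθ) (weightBound_nonneg μ ν t))

/-- Integration against a weight on the unit circle, as a linear functional. -/
def circleFunctional (w : ℂ → ℂ)
    (hw : IntervalIntegrable (fun θ : ℝ => w (Complex.exp (θ * Complex.I))) volume
      (-Real.pi) Real.pi) : C(ℝ, ℂ) →ₗ[ℂ] ℂ where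
  toFun g := (1 / (2 * (Real.pi : ℂ))) *
    ∫ θ in (-Real.pi)..Real.pi, w (Complex.exp (θ * Complex.I)) * g θ
  map_add' f g := by
    rw [← mul_add, ← intervalIntegral.integral_add
      (hw.mul_continuousOn f.continuous.continuousOn)
      (hw.mul_continuousOn g.continuous.continuousOn)]
    simp [mul_add]
  map_smul' c g := by
    simp only [ContinuousMap.smul_apply, smul_eq_mul, RingHom.id_apply, mul_left_comm _ c,
      intervalIntegral.integral_const_mul]

/-- The function `θ ↦ p(z) q(1/z)`, `z = e^{iθ}`. -/
def laurentMap (p q : ℂ[X]) : C(ℝ, ℂ) :=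
  ⟨fun θ => p.eval (Complex.exp (θ * Complex.I)) * q.eval (1 / Complex.exp (θ * Complex.I)), by
    simp only [one_div, ← Complex.exp_neg]
    fun_prop⟩

theorem laurentMap_apply (p q : ℂ[X]) (θ : ℝ) : laurentMap p q θ
    = p.eval (Complex.exp (θ * Complex.I)) * q.eval (1 / Complex.exp (θ * Complex.I)) := rfl

/-- The bilinear form `∫ w(z) p(z) q(1/z) dz/(2πiz)`. -/
def circleForm (w : ℂ → ℂ)
    (hw : IntervalIntegrable (fun θ : ℝ => w (Complex.exp (θ * Complex.I))) volume
      (-Real.pi) Real.pi) : ℂ[X] →ₗ[ℂ] ℂ[X] →ₗ[ℂ] ℂ :=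
  LinearMap.mk₂ ℂ (fun p q => circleFunctional w hw (laurentMap p q))
    (fun p p' q => by
      rw [← map_add]; congr 1; ext θ
      simp only [laurentMap_apply, ContinuousMap.add_apply, eval_add]; ring)
    (fun c p q => by
      rw [← map_smul]; congr 1; ext θ
      simp only [laurentMap_apply, ContinuousMap.smul_apply, eval_smul, smul_eq_mul]; ring)
    (fun p q q' => by
      rw [← map_add]; congr 1; ext θ
      simp only [laurentMap_apply, ContinuousMap.add_apply, eval_add]; ring)
    (fun c p q => by
      rw [← map_smul]; congr 1; ext θ
      simp only [laurentMap_apply, ContinuousMap.smul_apply, eval_smul, smul_eq_mul]; ring)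

theorem circleForm_eq_functional (w : ℂ → ℂ)
    (hw : IntervalIntegrable (fun θ : ℝ => w (Complex.exp (θ * Complex.I))) volume
      (-Real.pi) Real.pi) (p q : ℂ[X]) :
    circleForm w hw p q = circleFunctional w hw (laurentMap p q) := rfl

theorem circleForm_apply (w : ℂ → ℂ)
    (hw : IntervalIntegrable (fun θ : ℝ => w (Complex.exp (θ * Complex.I))) volume
      (-Real.pi) Real.pi) (p q : ℂ[X]) :
    circleForm w hw p q = circleMean fun z => w z * p.eval z * q.eval (1 / z) := by
  simp only [circleForm_eq_functional, circleFunctional, circleMean, LinearMap.coe_mk,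
    AddHom.coe_mk, laurentMap_apply, mul_assoc]

theorem isToeplitz_circleForm (w : ℂ → ℂ)
    (hw : IntervalIntegrable (fun θ : ℝ => w (Complex.exp (θ * Complex.I))) volume
      (-Real.pi) Real.pi) : IsToeplitz (circleForm w hw) := fun p q => by
  rw [circleForm_eq_functional, circleForm_eq_functional]
  congr 1
  ext θ
  have := Complex.exp_ne_zero (θ * Complex.I)
  simp only [laurentMap_apply, eval_mul, eval_X]
  field_simp

theorem circleForm_X_pow (w : ℂ → ℂ)
    (hw : IntervalIntegrable (fun θ : ℝ => w (Complex.exp (θ * Complex.I))) volume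
      (-Real.pi) Real.pi) (i j : ℕ) :
    circleForm w hw (X ^ i) (X ^ j) = fourierCoeff w ((j : ℤ) - (i : ℤ)) := by
  rw [circleForm_apply, fourierCoeff]
  unfold circleMean
  congr 1
  refine intervalIntegral.integral_congr fun θ _ => ?_
  have := Complex.exp_ne_zero (θ * Complex.I)
  simp only [eval_pow, eval_X, neg_sub, zpow_sub₀ this, zpow_natCast, one_div, inv_pow]
  field_simp

theorem isSemiclassical_circleForm {μ ν t : ℂ} (hμν : -1 < (μ + ν).re) :
    IsSemiclassical μ ν t (circleForm (weight μ ν t) (intervalIntegrable_weight t hμν)) := by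
  intro p q
  have hp := Real.pi_pos
  set hw := intervalIntegrable_weight t hμν
  set G : C(ℝ, ℂ) := laurentMap (X * derivative p) (X * q) + laurentMap (X * derivative p) q
    - laurentMap p (X * (q + X * derivative q)) - laurentMap p (q + X * derivative q)
    + t • laurentMap (X * p) q + (1 + μ + t) • laurentMap p q - ν • laurentMap p (X * q) with hG
  suffices h : circleFunctional (weight μ ν t) hw G = 0 by
    simp only [hG, map_add, map_sub, map_smul, smul_eq_mul] at h
    exact h
  -- The factor 1+1/z cancels the pole of w'/w at z = -1 and also raises the boundary exponent from
  -- Re(μ+ν) to Re(μ+ν)+1 > 0.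
  set F : ℝ → ℂ := fun θ => weight μ ν t (Complex.exp (θ * Complex.I))
    * (1 + 1 / Complex.exp (θ * Complex.I)) * laurentMap p q θ with hF
  have hder : ∀ θ ∈ Ioo (-Real.pi) Real.pi, HasDerivAt F
      (weight μ ν t (Complex.exp (θ * Complex.I)) * (Complex.I • G) θ) θ := fun θ hθ => by
    have h1 := hasDerivAt_weight μ ν t hθ
    have h2 := (hasDerivAt_inv_exp_mul_I θ).const_add 1
    have h3 := (p.hasDerivAt (Complex.exp (θ * Complex.I))).comp θ (hasDerivAt_exp_mul_I θ)
    have h4 := (q.hasDerivAt (1 / Complex.exp (θ * Complex.I))).comp θ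
      (hasDerivAt_inv_exp_mul_I θ)
    have h := (h1.mul h2).mul (h3.mul h4)
    refine h.congr_deriv ?_
    have hn0 := Complex.exp_ne_zero (θ * Complex.I)
    have hn1 := Complex.slitPlane_ne_zero (one_add_exp_mem_slitPlane hθ)
    simp only [hG, ContinuousMap.add_apply, ContinuousMap.sub_apply, ContinuousMap.smul_apply,
      laurentMap_apply, smul_eq_mul, eval_mul, eval_add, eval_X, Pi.mul_apply, Function.comp_apply]
    generalize weight μ ν t (Complex.exp (θ * Complex.I)) = W
    generalize eval (1 / Complex.exp (θ * Complex.I)) q = b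
    generalize eval (1 / Complex.exp (θ * Complex.I)) (derivative q) = b'
    generalize Complex.exp (θ * Complex.I) = z at *
    field_simp
    ring
  have hlim : ∀ a : ℝ, Real.cos (a / 2) = 0 → ∀ l : Filter ℝ, l ≤ 𝓝 a →
      (∀ᶠ θ in l, θ ∈ Ioo (-Real.pi) Real.pi) → Tendsto F l (𝓝 0) := fun a ha l hl hev => by
    have hρ : 0 < (μ + ν).re + 1 := by linarith
    have hc : Continuous fun θ : ℝ => weightBound μ ν t
        * (2 * Real.cos (θ / 2)) ^ ((μ + ν).re + 1) * ‖laurentMap p q θ‖ := by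
      have : Continuous fun θ : ℝ => (2 * Real.cos (θ / 2)) ^ ((μ + ν).re + 1) :=
        (by fun_prop : Continuous fun θ : ℝ => 2 * Real.cos (θ / 2)).rpow_const
          fun _ => Or.inr hρ.le
      fun_prop
    have h0 := hc.tendsto a
    rw [ha, mul_zero, Real.zero_rpow hρ.ne', mul_zero, zero_mul] at h0
    refine squeeze_zero_norm' ?_ (h0.mono_left hl)
    filter_upwards [hev] with θ hθ
    have hcp := cos_half_pos hθ
    simp only [hF]
    rw [norm_mul, norm_mul, norm_one_add_inv_exp hθ, Real.rpow_add (by positivity),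
      Real.rpow_one]
    refine mul_le_mul_of_nonneg_right ?_ (norm_nonneg _)
    rw [← mul_assoc (weightBound μ ν t)]
    exact mul_le_mul_of_nonneg_right (norm_weight_le μ ν t hθ) (by positivity)
  have hcos : Real.cos (Real.pi / 2) = 0 := Real.cos_pi_div_two
  have hint := intervalIntegral.integral_eq_sub_of_hasDerivAt_of_tendsto
    (by linarith : -Real.pi < Real.pi) hder
    (hw.mul_continuousOn (Complex.I • G).continuous.continuousOn)
    (hlim (-Real.pi) (by rw [neg_div, Real.cos_neg, hcos]) _ nhdsWithin_le_nhds
      (Ioo_mem_nhdsGT (by linarith)))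
    (hlim Real.pi hcos _ nhdsWithin_le_nhds (Ioo_mem_nhdsLT (by linarith)))
  have h2 : circleFunctional (weight μ ν t) hw (Complex.I • G) = 0 := by
    simp only [circleFunctional, LinearMap.coe_mk, AddHom.coe_mk, hint, sub_zero, mul_zero]
  rw [map_smul, smul_eq_mul, mul_eq_zero] at h2
  exact h2.resolve_left Complex.I_ne_zero

end PVWeight
end

/-! ### Existence of monic biorthogonal polynomials from non-zero Gram determinants. -/

noncomputable section

namespace PVWeight

open Polynomial

/-- If the Gram matrix of the first `n` monomials is invertible, there is a monic polynomial of
degree `n` that is left orthogonal to them. -/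
theorem exists_monic_orthogonal (B : ℂ[X] →ₗ[ℂ] ℂ[X] →ₗ[ℂ] ℂ) (n : ℕ)
    (hdet : (Matrix.of fun i j : Fin n => B (X ^ (i : ℕ)) (X ^ (j : ℕ))).det ≠ 0) :
    ∃ p : ℂ[X], p.coeff n = 1 ∧ (∀ m, n < m → p.coeff m = 0) ∧ ∀ j, j < n → B p (X ^ j) = 0 := by
  set M := Matrix.of fun i j : Fin n => B (X ^ (i : ℕ)) (X ^ (j : ℕ)) with hM
  set v : Fin n → ℂ := fun j => B (X ^ n) (X ^ (j : ℕ)) with hv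
  set a := Matrix.vecMul v M⁻¹ with ha
  have hav : Matrix.vecMul a M = v := by
    rw [ha, Matrix.vecMul_vecMul, Matrix.nonsing_inv_mul _ (isUnit_iff_ne_zero.2 hdet),
      Matrix.vecMul_one]
  have hlow : ∀ m, n ≤ m → (∑ i : Fin n, a i • (X : ℂ[X]) ^ (i : ℕ)).coeff m = 0 := fun m hm => by
    simp only [finsetSum_coeff, coeff_smul, coeff_X_pow]
    refine Finset.sum_eq_zero fun i _ => ?_
    rw [if_neg (by omega), smul_zero]
  refine ⟨X ^ n - ∑ i : Fin n, a i • (X : ℂ[X]) ^ (i : ℕ), ?_, fun m hm => ?_, fun j hj => ?_⟩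
  · rw [coeff_sub, hlow n le_rfl, coeff_X_pow_self, sub_zero]
  · rw [coeff_sub, hlow m hm.le, coeff_X_pow, if_neg (by omega), sub_zero]
  · have h1 := congrFun hav ⟨j, hj⟩
    simp only [Matrix.vecMul, dotProduct, hM, hv, Matrix.of_apply] at h1
    simp only [map_sub, map_sum, map_smul, LinearMap.sub_apply, LinearMap.sum_apply,
      LinearMap.smul_apply, smul_eq_mul, h1, sub_self]

theorem apply_eq_of_orthogonal {B : ℂ[X] →ₗ[ℂ] ℂ[X] →ₗ[ℂ] ℂ} {n : ℕ} {p q : ℂ[X]}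
    (hp : ∀ j, j < n → B p (X ^ j) = 0) (hq : ∀ m, n < m → q.coeff m = 0) :
    B p q = q.coeff n * B p (X ^ n) := by
  conv_lhs => rw [eq_sum_of_coeff_eq_zero hq]
  simp only [map_sum, map_smul, smul_eq_mul]
  rw [Finset.sum_range_succ, Finset.sum_eq_zero, zero_add]
  intro j hj
  rw [hp j (Finset.mem_range.1 hj), mul_zero]

/-- The coefficients of `p` form a non-zero left kernel vector. This rules out `h n = 0` in the
existence proof. -/
theorem det_eq_zero_of_orthogonal {B : ℂ[X] →ₗ[ℂ] ℂ[X] →ₗ[ℂ] ℂ} {n : ℕ} {p : ℂ[X]}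
    (hp1 : p.coeff n = 1) (hp : ∀ m, n < m → p.coeff m = 0)
    (h0 : ∀ j, j < n + 1 → B p (X ^ j) = 0) :
    (Matrix.of fun i j : Fin (n + 1) => B (X ^ (i : ℕ)) (X ^ (j : ℕ))).det = 0 := by
  refine Matrix.exists_vecMul_eq_zero_iff.1 ⟨fun i => p.coeff i, fun h => ?_, ?_⟩
  · have := congrFun h (Fin.last n)
    simp [hp1] at this
  · ext j
    have h1 := h0 j j.2
    rw [eq_sum_of_coeff_eq_zero hp] at h1
    simpa [Matrix.vecMul, dotProduct, Finset.sum_range, map_sum] using h1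

theorem exists_isMonicBiorthogonal (B : ℂ[X] →ₗ[ℂ] ℂ[X] →ₗ[ℂ] ℂ)
    (hdet : ∀ n, (Matrix.of fun i j : Fin n => B (X ^ (i : ℕ)) (X ^ (j : ℕ))).det ≠ 0) :
    ∃ P Q h, IsMonicBiorthogonal B P Q h := by
  choose P hP1 hP hPo using fun n => exists_monic_orthogonal B n (hdet n)
  choose Q hQ1 hQ hQo using fun n => exists_monic_orthogonal B.flip n (by
    have := hdet n
    rw [← Matrix.det_transpose] at this
    exact this)
  refine ⟨P, Q, fun n => B (P n) (X ^ n), hP1, hQ1, hP, hQ, fun m n => ?_, fun n h => ?_⟩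
  · rcases lt_trichotomy m n with hmn | rfl | hmn
    · have := apply_eq_of_orthogonal (hQo n) (fun k hk => hP m k (by omega))
      rw [LinearMap.flip_apply, hP m n hmn, zero_mul] at this
      rw [this, if_neg hmn.ne]
    · rw [if_pos rfl, apply_eq_of_orthogonal (hPo m) (hQ m), hQ1, one_mul]
    · rw [apply_eq_of_orthogonal (hPo m) (fun k hk => hQ n k (by omega)), hQ n m hmn, zero_mul,
        if_neg hmn.ne']
  · refine hdet (n + 1) (det_eq_zero_of_orthogonal (hP1 n) (hP n) fun j hj => ?_)
    rcases (Nat.lt_succ_iff.1 hj).lt_or_eq with hj | rfl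
    · exact hPo n j hj
    · exact h

end PVWeight
end

/-! ### Passage between orthonormal systems and monic biorthogonal ones. -/

noncomputable section

namespace PVWeight

open Polynomial MeasureTheory

variable {w : ℂ → ℂ} {hw : IntervalIntegrable
  (fun θ : ℝ => w (Complex.exp (θ * Complex.I))) volume (-Real.pi) Real.pi}

theorem circleMean_normalized (p q : ℂ[X]) :
    circleMean (fun z => w z / fourierCoeff w 0 * p.eval z * q.eval (1 / z))
      = (fourierCoeff w 0)⁻¹ * circleForm w hw p q := by
  rw [circleForm_apply]
  simp only [circleMean, div_eq_inv_mul, mul_assoc, intervalIntegral.integral_const_mul]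
  ring

theorem det_circleForm (n : ℕ) :
    (Matrix.of fun i j : Fin n => circleForm w hw (X ^ (i : ℕ)) (X ^ (j : ℕ))).det
      = toeplitzDet w n := by
  rw [toeplitzDet, ← Matrix.det_transpose]
  congr 1
  ext i j
  simp only [Matrix.transpose_apply, Matrix.of_apply, circleForm_X_pow]

theorem IsMonicBiorthogonal.exists_isOrthonormalSystem {P Q : ℕ → ℂ[X]} {h : ℕ → ℂ}
    (H : IsMonicBiorthogonal (circleForm w hw) P Q h) (h0 : fourierCoeff w 0 ≠ 0) :
    ∃ φ φbar : ℕ → ℂ[X], IsOrthonormalSystem w φ φbar := by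
  -- One square root of w_0/h_n scales both P_n and Q_n, so the leading coefficients agree.
  choose κ hκ using fun n =>
    IsAlgClosed.exists_pow_nat_eq (fourierCoeff w 0 / h n) (zero_lt_two : 0 < 2)
  have hκ0 : ∀ n, κ n ≠ 0 := fun n hn => by
    have := hκ n
    rw [hn, zero_pow two_ne_zero, eq_comm, div_eq_zero_iff] at this
    exact this.elim h0 (H.ne_zero n)
  have hdeg : ∀ {R : ℕ → ℂ[X]}, (∀ n, (R n).coeff n = 1) → (∀ n m, n < m → (R n).coeff m = 0) →
      ∀ n, (κ n • R n).natDegree = n := fun h1 h2 n => by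
    refine natDegree_eq_of_le_of_coeff_ne_zero (natDegree_le_iff_coeff_eq_zero.2 fun m hm => ?_) ?_
    · rw [coeff_smul, h2 n m hm, smul_zero]
    · rw [coeff_smul, h1, smul_eq_mul, mul_one]
      exact hκ0 n
  have hdP := hdeg H.coeff_left H.coeff_left_of_lt
  have hdQ := hdeg H.coeff_right H.coeff_right_of_lt
  refine ⟨fun n => κ n • P n, fun n => κ n • Q n, hdP, hdQ, fun n => ?_, fun m n => ?_⟩
  · simp only [leadingCoeff, hdP, hdQ, coeff_smul, H.coeff_left, H.coeff_right]
  · rw [circleMean_normalized (hw := hw)]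
    simp only [map_smul, LinearMap.smul_apply, H.orth, smul_eq_mul]
    by_cases hmn : m = n
    · subst hmn
      have hm := hκ m
      have hh := H.ne_zero m
      rw [if_pos rfl, if_pos rfl]
      field_simp at hm ⊢
      linear_combination hm
    · simp [hmn]

/-- Division by zero gives 0, so w_0 = 0 would make every normalised integral vanish, against
orthonormality at m = n = 0. -/
theorem IsOrthonormalSystem.fourierCoeff_ne_zero {φ φbar : ℕ → ℂ[X]}
    (H : IsOrthonormalSystem w φ φbar) : fourierCoeff w 0 ≠ 0 := fun h0 => by
  have := H.orthonormal 0 0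
  simp [h0, circleMean] at this

theorem IsOrthonormalSystem.leadingCoeff_ne_zero {φ φbar : ℕ → ℂ[X]}
    (H : IsOrthonormalSystem w φ φbar) (n : ℕ) : (φ n).leadingCoeff ≠ 0 := fun h0 => by
  rw [leadingCoeff_eq_zero] at h0
  have := H.orthonormal n n
  simp [h0, circleMean] at this

theorem IsOrthonormalSystem.isMonicBiorthogonal {φ φbar : ℕ → ℂ[X]}
    (H : IsOrthonormalSystem w φ φbar) :
    IsMonicBiorthogonal (circleForm w hw) (fun n => (φ n).leadingCoeff⁻¹ • φ n)
      (fun n => (φbar n).leadingCoeff⁻¹ • φbar n)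
      (fun n => fourierCoeff w 0 / (φ n).leadingCoeff ^ 2) where
  coeff_left n := by
    have h := H.leadingCoeff_ne_zero n
    rw [leadingCoeff, H.natDegree_eq] at *
    rw [coeff_smul, smul_eq_mul, inv_mul_cancel₀ h]
  coeff_right n := by
    have h := H.leadingCoeff_ne_zero n
    rw [← H.leadingCoeff_eq, leadingCoeff, H.natDegree_bar_eq] at h
    rw [leadingCoeff, H.natDegree_bar_eq, coeff_smul, smul_eq_mul, inv_mul_cancel₀ h]
  coeff_left_of_lt n m hm := by
    rw [coeff_smul, coeff_eq_zero_of_natDegree_lt (by rwa [H.natDegree_eq]), smul_zero]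
  coeff_right_of_lt n m hm := by
    rw [coeff_smul, coeff_eq_zero_of_natDegree_lt (by rwa [H.natDegree_bar_eq]), smul_zero]
  orth m n := by
    have h0 := H.fourierCoeff_ne_zero
    have hm := H.leadingCoeff_ne_zero m
    have h := H.orthonormal m n
    rw [circleMean_normalized (hw := hw), inv_mul_eq_iff_eq_mul₀ h0] at h
    simp only [map_smul, LinearMap.smul_apply, h, smul_eq_mul, H.leadingCoeff_eq]
    by_cases hmn : m = n
    · subst hmn
      rw [if_pos rfl, if_pos rfl]
      field_simp
    · simp [hmn]
  ne_zero n := div_ne_zero H.fourierCoeff_ne_zero (pow_ne_zero 2 (H.leadingCoeff_ne_zero n))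

theorem coeff_zero_eq_reflectionCoeff (φ : ℕ → ℂ[X]) (n : ℕ) :
    ((φ n).leadingCoeff⁻¹ • φ n).coeff 0 = reflectionCoeff φ n := by
  rw [coeff_smul, smul_eq_mul, reflectionCoeff, coeff_zero_eq_eval_zero, div_eq_inv_mul]

end PVWeight
end

theorem mainTheorem7 (μ ν t : ℂ) (hμν : -1 < (μ + ν).re)
    (hI : ∀ n : ℕ, 1 ≤ n → PVWeight.toeplitzDet (PVWeight.weight μ ν t) n ≠ 0) :
    (∃ φ φbar : ℕ → Polynomial ℂ,
      PVWeight.IsOrthonormalSystem (PVWeight.weight μ ν t) φ φbar) ∧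
    ∀ φ φbar : ℕ → Polynomial ℂ,
      PVWeight.IsOrthonormalSystem (PVWeight.weight μ ν t) φ φbar →
      ∀ r rbar : ℕ → ℂ,
        r = PVWeight.reflectionCoeff φ →
        rbar = PVWeight.reflectionCoeff φbar →
        ∀ N : ℕ, 1 ≤ N →
          (1 - r N * rbar N) * (t * r (N + 1) + (N + ν) * r N)
              * (t * rbar (N - 1) + (N + ν) * rbar N)
            = ((N + ν) * (r N * rbar N) + μ) * (ν - (N + ν) * (r N * rbar N)) ∧
          t ^ 2 * r N ^ 2 * rbar (N - 1) ^ 2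
              + t * (ν - μ - t) * (r N * rbar (N - 1))
              - (N + ν) * (N - 1 + ν) * (rbar N * r (N - 1))
              - (N - 1 + ν) * t * (r (N - 1) * rbar (N - 1))
              - (N + ν) * t * (r N * rbar N) - μ * ν = 0 := by
  have hw := PVWeight.intervalIntegrable_weight t hμν
  have hB := PVWeight.isToeplitz_circleForm _ hw
  have hS := PVWeight.isSemiclassical_circleForm (t := t) hμν
  refine ⟨?_, ?_⟩
  · have hdet : ∀ n, PVWeight.toeplitzDet (PVWeight.weight μ ν t) n ≠ 0 := fun n => by
      rcases Nat.eq_zero_or_pos n with rfl | hn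
      · simp [PVWeight.toeplitzDet]
      · exact hI n hn
    obtain ⟨P, Q, h, H⟩ := PVWeight.exists_isMonicBiorthogonal
      (PVWeight.circleForm (PVWeight.weight μ ν t) hw)
      fun n => by rw [PVWeight.det_circleForm]; exact hdet n
    -- The determinant of size 1 is w_0.
    refine H.exists_isOrthonormalSystem fun h0 => hdet 1 ?_
    simp [PVWeight.toeplitzDet, h0]
  · rintro φ φbar hφ r rbar rfl rfl N hN
    obtain ⟨n, rfl⟩ : ∃ n, N = n + 1 := ⟨N - 1, by omega⟩
    have H := hφ.isMonicBiorthogonal (hw := hw)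
    have h1 := H.product_relation hB hS n
    have h2 := H.quadratic_relation hB hS n
    simp only [PVWeight.coeff_zero_eq_reflectionCoeff] at h1 h2
    rw [Nat.add_sub_cancel]
    push_cast
    refine ⟨h1, ?_⟩
    linear_combination h2
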